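/- Let $\alpha=(\alpha_n)_{n\ge 1}$ be a strictly increasing sequence of positive real numbers with $\alpha_n\to\infty$. Let $(s_k)_{k\ge 1}\subset(1,\infty)$ be a strictly increasing sequence with $s_k\to\infty$, and put $v_k(n):=s_k^{-\alpha_n}$ for $k,n\ge 1$. Let $c_0(v_k)$ be the Banach space of all complex sequences $x=(x_n)_{n\ge 1}$ with $\lim_{n\to\infty} v_k(n)|x_n|=0$, normed by $q_k(x)=\sup_n v_k(n)|x_n|$. Let $E_\alpha:=\operatorname{ind}_k c_0(v_k)$, that is, the increasing union $\bigcup_k c_0(v_k)$ endowed with the finest locally convex Hausdorff topology for which all inclusions $c_0(v_k)\hookrightarrow E_\alpha$ are continuous. (The space $E_\alpha$ does not depend on the choice of $(s_k)$.) Let $\mathsf C\colon E_\alpha\to E_\alpha$ be the Cesàro operator $$\mathsf C x=\Big(x_1,\frac{x_1+x_2}{2},\ldots,\frac{x_1+\cdots+x_n}{n},\ldots\Big),$$ which is a continuous linear operator on $E_\alpha$, and let $I$ be the identity operator. If the locally convex space $E_\alpha$ is nuclear, then the range $(I-\mathsf C)^m(E_\alpha)$ is a closed subspace of $E_\alpha$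 for every $m\in\mathbb N$. -/

import Mathlib

open Filter Topology

/-! Sequences `(x_n)` with `n = 1, 2, 3, …` are indexed here by `ℕ = {0, 1, 2, …}`: the value at
`n : ℕ` is the term of number `n + 1`. -/

noncomputable section

/-! ### Nuclear operators and nuclear locally convex spaces -/

/-- A linear operator between normed spaces is nuclear if `T x = ∑ₙ fₙ(x) yₙ` with continuous
linear functionals `fₙ` and vectors `yₙ` such that `∑ₙ ‖fₙ‖ ‖yₙ‖ < ∞`. -/
def IsNuclearOperator {X Y : Type*} [NormedAddCommGroup X] [NormedSpace ℂ X]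
    [NormedAddCommGroup Y] [NormedSpace ℂ Y] (T : X →L[ℂ] Y) : Prop :=
  ∃ (f : ℕ → X →L[ℂ] ℂ) (y : ℕ → Y), Summable (fun n => ‖f n‖ * ‖y n‖) ∧
    ∀ x, HasSum (fun n => f n x • y n) (T x)

section LocalBanach

variable {E : Type*} [AddCommGroup E] [Module ℂ E]

/-- The vector space `E`, seminormed by `p`. -/
def SeminormedBy (_p : Seminorm ℂ E) : Type _ := E

instance (p : Seminorm ℂ E) : AddCommGroup (SeminormedBy p) := inferInstanceAs (AddCommGroup E)

instance (p : Seminorm ℂ E) : Module ℂ (SeminormedBy p) := inferInstanceAs (Module ℂ E)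

instance (p : Seminorm ℂ E) : SeminormedAddCommGroup (SeminormedBy p) :=
  AddGroupSeminorm.toSeminormedAddCommGroup (E := SeminormedBy p) p.toAddGroupSeminorm

instance (p : Seminorm ℂ E) : NormedSpace ℂ (SeminormedBy p) where
  norm_smul_le a x := (map_smul_eq_mul p a x).le

/-- The local Banach space of the seminorm `p`: the Hausdorff completion of `(E, p)`, that is,
the completion of the normed space `E / ker p`. -/
abbrev LocalBanach (p : Seminorm ℂ E) : Type _ := UniformSpace.Completion (SeminormedBy p)

/-- For `p ≤ q`, the identity of `E` as a continuous linear map `(E, q) → (E, p)`. -/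
def seminormedMap {p q : Seminorm ℂ E} (h : p ≤ q) : SeminormedBy q →L[ℂ] SeminormedBy p :=
  LinearMap.mkContinuous
    { toFun := fun x => (x : E)
      map_add' := fun _ _ => rfl
      map_smul' := fun _ _ => rfl } 1
    (fun x => by rw [one_mul]; exact h x)

/-- For `p ≤ q`, the canonical linking map between the local Banach spaces of `q` and `p`. -/
def linkingMap {p q : Seminorm ℂ E} (h : p ≤ q) : LocalBanach q →L[ℂ] LocalBanach p :=
  (seminormedMap h).completion

end LocalBanach

/-- A locally convex space is nuclear if for every continuous seminorm `p` there is a continuous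
seminorm `q ≥ p` for which the linking map between the local Banach spaces of `q` and `p` is
nuclear. -/
def IsNuclearLCS (E : Type*) [AddCommGroup E] [Module ℂ E] [TopologicalSpace E] : Prop :=
  ∀ p : Seminorm ℂ E, Continuous p →
    ∃ (q : Seminorm ℂ E) (h : p ≤ q), Continuous q ∧ IsNuclearOperator (linkingMap h)

/-! ### The weighted Banach spaces `c₀(v)` -/

/-- The sequences `x` with `v(n) x_n → 0`, as a space of complex sequences. -/
def c0Submodule (v : ℕ → ℝ) : Submodule ℂ (ℕ → ℂ) where
  carrier := {x | Tendsto (fun n => (v n : ℂ) * x n) atTop (𝓝 0)}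
  zero_mem' := by simp
  add_mem' {x y} hx hy := by
    simpa [mul_add] using Tendsto.add hx hy
  smul_mem' c x hx := by
    have h := Tendsto.const_mul c hx
    simp only [mul_zero] at h
    refine h.congr fun n => ?_
    simp only [Pi.smul_apply, smul_eq_mul]
    ring

/-- The space `c₀(v)`, which carries the topology of its norm (see below) and not the topology
of coordinatewise convergence. -/
def C0Weighted (v : ℕ → ℝ) : Type := c0Submodule v

namespace C0Weighted

variable {v : ℕ → ℝ}

instance : AddCommGroup (C0Weighted v) := inferInstanceAs (AddCommGroup (c0Submodule v))

instance : Module ℂ (C0Weighted v) := inferInstanceAs (Module ℂ (c0Submodule v))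

/-- The norm `q_v(x) = sup_n v(n) |x_n|` of `c₀(v)`, for a positive weight `v`. -/
def supNorm (x : C0Weighted v) : ℝ := ⨆ n, ‖(v n : ℂ) * x.1 n‖

theorem bddAbove (x : C0Weighted v) : BddAbove (Set.range fun n => ‖(v n : ℂ) * x.1 n‖) :=
  (Tendsto.norm x.2).bddAbove_range

theorem le_supNorm (x : C0Weighted v) (n : ℕ) : ‖(v n : ℂ) * x.1 n‖ ≤ x.supNorm :=
  le_ciSup x.bddAbove n

/-- `q_v` as a seminorm (it is a norm if `v` has no zeros). -/
def seminorm (v : ℕ → ℝ) : Seminorm ℂ (C0Weighted v) :=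
  Seminorm.of supNorm
    (fun x y => by
      refine ciSup_le fun n => ?_
      have h : (v n : ℂ) * (x + y).1 n = (v n : ℂ) * x.1 n + (v n : ℂ) * y.1 n :=
        mul_add _ _ _
      rw [h]
      exact (norm_add_le _ _).trans (add_le_add (x.le_supNorm n) (y.le_supNorm n)))
    (fun a x => by
      rw [supNorm, supNorm, Real.mul_iSup_of_nonneg (norm_nonneg a)]
      refine iSup_congr fun n => ?_
      have h : (v n : ℂ) * (a • x).1 n = a * ((v n : ℂ) * x.1 n) :=
        mul_left_comm _ _ _
      rw [h, norm_mul])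

instance : SeminormedAddCommGroup (C0Weighted v) :=
  AddGroupSeminorm.toSeminormedAddCommGroup (seminorm v).toAddGroupSeminorm

instance : NormedSpace ℂ (C0Weighted v) where
  norm_smul_le a x := (map_smul_eq_mul (seminorm v) a x).le

theorem norm_eq (x : C0Weighted v) : ‖x‖ = ⨆ n, ‖(v n : ℂ) * x.1 n‖ := rfl

theorem le_norm (x : C0Weighted v) (n : ℕ) : ‖(v n : ℂ) * x.1 n‖ ≤ ‖x‖ := x.le_supNorm n

end C0Weighted

/-! ### The co-echelon space `E_α = ind_k c₀(v_k)` -/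

/-- The weights `v_k(n) = s_k ^ (-α_n)`. -/
def coWeight (s α : ℕ → ℝ) (k n : ℕ) : ℝ := s k ^ (-α n)

/-- The linear span of the spaces `c₀(v_k)` for all `k`, which is their union as soon as they
increase with `k` (see `mem_coechelonSubmodule`). -/
def coechelonSubmodule (s α : ℕ → ℝ) : Submodule ℂ (ℕ → ℂ) := ⨆ k, c0Submodule (coWeight s α k)

theorem coWeight_pos {s : ℕ → ℝ} (α : ℕ → ℝ) (hs : ∀ k, 1 < s k) (k n : ℕ) :
    0 < coWeight s α k n :=
  Real.rpow_pos_of_pos (zero_lt_one.trans (hs k)) _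

theorem coWeight_antitone {s α : ℕ → ℝ} (hs : ∀ k, 1 < s k) (hα : StrictMono α) (k : ℕ) :
    Antitone (coWeight s α k) := fun _ _ h =>
  Real.rpow_le_rpow_of_exponent_le (hs k).le (neg_le_neg (hα.monotone h))

theorem c0Submodule_mono {s α : ℕ → ℝ} (hs : ∀ k, 1 < s k) (hsm : StrictMono s)
    (hα : ∀ n, 0 < α n) : Monotone fun k => c0Submodule (coWeight s α k) := by
  intro k l hkl x hx
  refine squeeze_zero_norm (fun n => ?_) (tendsto_zero_iff_norm_tendsto_zero.1 hx)
  rw [norm_mul, norm_mul, Complex.norm_real, Complex.norm_real,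
    Real.norm_of_nonneg (coWeight_pos α hs l n).le, Real.norm_of_nonneg (coWeight_pos α hs k n).le]
  exact mul_le_mul_of_nonneg_right (Real.rpow_le_rpow_of_nonpos (zero_lt_one.trans (hs k))
    (hsm.monotone hkl) (neg_nonpos.2 (hα n).le)) (norm_nonneg _)

/-- `E_α` is the union of the spaces `c₀(v_k)`. -/
theorem mem_coechelonSubmodule {s α : ℕ → ℝ} (hs : ∀ k, 1 < s k) (hsm : StrictMono s)
    (hα : ∀ n, 0 < α n) {x : ℕ → ℂ} :
    x ∈ coechelonSubmodule s α ↔ ∃ k, x ∈ c0Submodule (coWeight s α k) :=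
  Submodule.mem_iSup_of_directed _ (c0Submodule_mono hs hsm hα).directed_le

/-- The space `E_α`, which carries the inductive limit topology (see below) and not the topology
of coordinatewise convergence. -/
def CoEchelon (s α : ℕ → ℝ) : Type := coechelonSubmodule s α

namespace CoEchelon

variable {s α : ℕ → ℝ}

instance : AddCommGroup (CoEchelon s α) := inferInstanceAs (AddCommGroup (coechelonSubmodule s α))

instance : Module ℂ (CoEchelon s α) := inferInstanceAs (Module ℂ (coechelonSubmodule s α))

/-- The inclusion `c₀(v_k) → E_α`. -/
def incl (s α : ℕ → ℝ) (k : ℕ) : C0Weighted (coWeight s α k) →ₗ[ℂ] CoEchelon s α :=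
  Submodule.inclusion (le_iSup (fun k => c0Submodule (coWeight s α k)) k)

/-- The topology of `E_α = ind_k c₀(v_k)`: the finest locally convex vector space topology for
which all inclusions `c₀(v_k) → E_α` are continuous. It is Hausdorff, see `t2Space`. -/
instance : TopologicalSpace (CoEchelon s α) :=
  sInf {t : TopologicalSpace (CoEchelon s α) |
    @IsTopologicalAddGroup (CoEchelon s α) t _ ∧
    @ContinuousSMul ℂ (CoEchelon s α) _ _ t ∧
    @LocallyConvexSpace ℝ (CoEchelon s α) _ _ _ _ t ∧
    ∀ k, @Continuous _ _ _ t (incl s α k)}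

instance : IsTopologicalAddGroup (CoEchelon s α) :=
  topologicalAddGroup_sInf fun _ ht => ht.1

instance : ContinuousSMul ℂ (CoEchelon s α) :=
  continuousSMul_sInf fun _ ht => ht.2.1

instance : LocallyConvexSpace ℝ (CoEchelon s α) :=
  LocallyConvexSpace.sInf fun _ ht => ht.2.2.1

theorem continuous_incl (k : ℕ) : Continuous (incl s α k) :=
  continuous_sInf_rng.2 fun _ ht => ht.2.2.2 k

/-- The universal property of the inductive limit. -/
theorem continuous_iff {F : Type*} [AddCommGroup F] [Module ℂ F] [tF : TopologicalSpace F]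
    [IsTopologicalAddGroup F] [ContinuousSMul ℂ F] [LocallyConvexSpace ℝ F]
    (T : CoEchelon s α →ₗ[ℂ] F) : Continuous T ↔ ∀ k, Continuous (T ∘ incl s α k) := by
  refine ⟨fun h k => h.comp (continuous_incl k), fun h => ?_⟩
  rw [continuous_iff_le_induced]
  refine sInf_le ⟨topologicalAddGroup_induced T, continuousSMul_induced T,
    LocallyConvexSpace.induced (T.restrictScalars ℝ), fun k => ?_⟩
  exact continuous_induced_rng.2 (h k)

/-- The coordinate functional `x ↦ x_n` of `E_α`. -/
def coord (s α : ℕ → ℝ) (n : ℕ) : CoEchelon s α →ₗ[ℂ] ℂ :=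
  (LinearMap.proj n).comp (coechelonSubmodule s α).subtype

theorem continuous_coord (hs : ∀ k, 1 < s k) (n : ℕ) : Continuous (coord s α n) := by
  refine (continuous_iff _).2 fun k => ?_
  refine AddMonoidHomClass.continuous_of_bound ((coord s α n).comp (incl s α k))
    (coWeight s α k n)⁻¹ fun x => ?_
  have h := x.le_norm n
  rw [norm_mul, Complex.norm_real, Real.norm_of_nonneg (coWeight_pos α hs k n).le] at h
  have h2 := (le_inv_mul_iff₀ (coWeight_pos α hs k n)).2 h
  exact h2

theorem t2Space (hs : ∀ k, 1 < s k) : T2Space (CoEchelon s α) := by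
  refine T2Space.of_injective_continuous
    (f := fun (x : CoEchelon s α) (n : ℕ) => coord s α n x) (fun x y h => ?_)
    (continuous_pi fun n => continuous_coord hs n)
  exact Subtype.ext h

end CoEchelon

/-! ### The Cesàro operator -/

/-- The Cesàro operator `x ↦ (x_1, (x_1 + x_2) / 2, (x_1 + x_2 + x_3) / 3, …)` on the space of all
complex sequences. -/
def cesaro : (ℕ → ℂ) →ₗ[ℂ] (ℕ → ℂ) where
  toFun x n := (∑ i ∈ Finset.range (n + 1), x i) / ((n : ℂ) + 1)
  map_add' x y := by
    funext n
    simp [Finset.sum_add_distrib, add_div]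
  map_smul' c x := by
    funext n
    simp [← Finset.mul_sum, mul_div_assoc]

theorem norm_weight_mul_cesaro_le {v : ℕ → ℝ} (hv : ∀ n, 0 < v n) (hva : Antitone v)
    (x : ℕ → ℂ) (n : ℕ) : ‖(v n : ℂ) * cesaro x n‖ ≤
      ((n : ℝ) + 1)⁻¹ * ∑ i ∈ Finset.range (n + 1), ‖(v i : ℂ) * x i‖ := by
  have h1 : ‖(n : ℂ) + 1‖ = (n : ℝ) + 1 := by
    have h : ((n : ℂ) + 1) = (((n : ℝ) + 1 : ℝ) : ℂ) := by push_cast; rfl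
    rw [h, Complex.norm_real, Real.norm_of_nonneg (by positivity)]
  have h2 : ‖(v n : ℂ) * ∑ i ∈ Finset.range (n + 1), x i‖ ≤
      ∑ i ∈ Finset.range (n + 1), ‖(v i : ℂ) * x i‖ := by
    rw [Finset.mul_sum]
    refine (norm_sum_le _ _).trans (Finset.sum_le_sum fun i hi => ?_)
    rw [norm_mul, norm_mul, Complex.norm_real, Complex.norm_real,
      Real.norm_of_nonneg (hv n).le, Real.norm_of_nonneg (hv i).le]
    exact mul_le_mul_of_nonneg_right (hva (Finset.mem_range_succ_iff.1 hi)) (norm_nonneg _)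
  have h3 : (v n : ℂ) * cesaro x n =
      ((v n : ℂ) * ∑ i ∈ Finset.range (n + 1), x i) / ((n : ℂ) + 1) :=
    (mul_div_assoc _ _ _).symm
  rw [h3, norm_div, h1, div_eq_inv_mul]
  exact mul_le_mul_of_nonneg_left h2 (by positivity)

theorem cesaro_mem_c0 {v : ℕ → ℝ} (hv : ∀ n, 0 < v n) (hva : Antitone v) {x : ℕ → ℂ}
    (hx : x ∈ c0Submodule v) : cesaro x ∈ c0Submodule v := by
  have h := (Filter.Tendsto.cesaro (tendsto_zero_iff_norm_tendsto_zero.1 hx)).comp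
    (tendsto_add_atTop_nat 1)
  refine squeeze_zero_norm (fun n => norm_weight_mul_cesaro_le hv hva x n) (h.congr fun n => ?_)
  simp

theorem cesaro_mem_coechelon {s α : ℕ → ℝ} (hs : ∀ k, 1 < s k) (hα : StrictMono α) (x : ℕ → ℂ)
    (hx : x ∈ coechelonSubmodule s α) : cesaro x ∈ coechelonSubmodule s α := by
  have h : coechelonSubmodule s α ≤ (coechelonSubmodule s α).comap cesaro := by
    refine iSup_le fun k y hy => ?_
    exact le_iSup (fun k => c0Submodule (coWeight s α k)) k
      (cesaro_mem_c0 (coWeight_pos α hs k) (coWeight_antitone hs hα k) hy)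
  exact h hx

namespace CoEchelon

variable {s α : ℕ → ℝ}

/-- The Cesàro operator as a linear map of `E_α` into itself. -/
def cesaroLinearMap (hs : ∀ k, 1 < s k) (hα : StrictMono α) :
    CoEchelon s α →ₗ[ℂ] CoEchelon s α :=
  cesaro.restrict (cesaro_mem_coechelon hs hα)

theorem continuous_cesaroLinearMap (hs : ∀ k, 1 < s k) (hα : StrictMono α) :
    Continuous (cesaroLinearMap hs hα) := by
  refine (continuous_iff _).2 fun k => ?_
  have hv := coWeight_pos α hs k
  have hva := coWeight_antitone hs hα k
  let C : C0Weighted (coWeight s α k) →ₗ[ℂ] C0Weighted (coWeight s α k) :=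
    cesaro.restrict fun _ hx => cesaro_mem_c0 hv hva hx
  have hC : Continuous C := by
    refine AddMonoidHomClass.continuous_of_bound C 1 fun x => ?_
    rw [one_mul]
    refine ciSup_le fun n => (norm_weight_mul_cesaro_le hv hva x.1 n).trans ?_
    have h := Finset.sum_le_card_nsmul (Finset.range (n + 1))
      (fun i => ‖(coWeight s α k i : ℂ) * x.1 i‖) ‖x‖ fun i _ => x.le_norm i
    rw [Finset.card_range, nsmul_eq_mul, Nat.cast_succ] at h
    exact (inv_mul_le_iff₀ (by positivity)).2 h
  exact (continuous_incl k).comp hC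

/-- The Cesàro operator as a continuous linear operator on `E_α`. -/
def cesaroCLM (hs : ∀ k, 1 < s k) (hα : StrictMono α) : CoEchelon s α →L[ℂ] CoEchelon s α :=
  ⟨cesaroLinearMap hs hα, continuous_cesaroLinearMap hs hα⟩

end CoEchelon

end

/-! For `m ≥ 1` the range of `(I - C)^m` is the hyperplane `H = {x | x_1 = 0}`, the kernel of a
continuous functional; for `m = 0` it is the whole space.

The range of `I - C` lies in `H` because the first Cesàro mean of `x` is `x_1`. Conversely, for `y ∈
H` the equation `x - C x = y` is solved by `x = y + z`, where `z_n` sums `y_j / (j - 1)` over `2 ≤ j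
≤ n` (`cesaro_add_eq`). The only question is whether `z` lies in `E_α`. Summing `n` terms costs a
factor of order `n`, which is harmless once `log n = O(α_n)`, since a larger `s_l` then absorbs it.
As `x` is again in `H`, the step can be iterated.

Nuclearity enters only through this growth condition (`exists_le_mul_rpow_of_isNuclearLCS`). If it
fails, there is a continuous seminorm that is too large on long blocks of unit vectors. Their
unimodular combinations stay in the unit ball of the first step, so no linking map into the local
space of that seminorm is absolutely summing, hence none is nuclear. -/

/-! ### Nuclear operators are absolutely summing -/

/-- A nuclear operator is absolutely summing: a finite family whose unimodular combinations are
bounded by `C` is mapped to a family whose norms have a sum bounded by a multiple of `C`. -/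
theorem IsNuclearOperator.exists_sum_norm_le {X Y : Type*} [NormedAddCommGroup X]
    [NormedSpace ℂ X] [NormedAddCommGroup Y] [NormedSpace ℂ Y] {T : X →L[ℂ] Y}
    (hT : IsNuclearOperator T) :
    ∃ K : ℝ, ∀ (C : ℝ) (A : Finset ℕ) (x : ℕ → X),
      (∀ ε : ℕ → ℂ, (∀ n, ‖ε n‖ ≤ 1) → ‖∑ n ∈ A, ε n • x n‖ ≤ C) →
      ∑ n ∈ A, ‖T (x n)‖ ≤ K * C := by
  obtain ⟨f, y, hfy, hT⟩ := hT
  refine ⟨∑' j, ‖f j‖ * ‖y j‖, fun C A x hx => ?_⟩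
  have hs : ∀ z : X, Summable fun j => ‖f j z‖ * ‖y j‖ := fun z =>
    (hfy.mul_left ‖z‖).of_nonneg_of_le (fun j => by positivity) fun j => by
      have h := mul_le_mul_of_nonneg_right ((f j).le_opNorm z) (norm_nonneg (y j))
      linarith
  have hle : ∀ z : X, ‖T z‖ ≤ ∑' j, ‖f j z‖ * ‖y j‖ := fun z => by
    rw [← (hT z).tsum_eq]
    have h := norm_tsum_le_tsum_norm (f := fun j => f j z • y j)
      (by simpa only [norm_smul] using hs z)
    simpa only [norm_smul] using h
  have hf : ∀ j, ∑ n ∈ A, ‖f j (x n)‖ ≤ ‖f j‖ * C := fun j => by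
    -- Phases that align the values `f j (x n)`, so that `f j` of one combination is the sum of
    -- their moduli.
    have hε : ∀ w : ℂ, ∃ ε : ℂ, ‖ε‖ ≤ 1 ∧ ε * w = ‖w‖ := fun w => by
      rcases eq_or_ne w 0 with rfl | hw
      · exact ⟨0, by simp, by simp⟩
      · exact ⟨‖w‖ / w, by simp [hw], by field_simp⟩
    choose ε hε1 hε2 using fun n => hε (f j (x n))
    have h : f j (∑ n ∈ A, ε n • x n) = ((∑ n ∈ A, ‖f j (x n)‖ : ℝ) : ℂ) := by
      simp [hε2]
    have h2 := (f j).le_opNorm (∑ n ∈ A, ε n • x n)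
    rw [h, Complex.norm_real] at h2
    exact (le_abs_self _).trans
      (h2.trans (mul_le_mul_of_nonneg_left (hx ε hε1) (norm_nonneg _)))
  calc ∑ n ∈ A, ‖T (x n)‖ ≤ ∑ n ∈ A, ∑' j, ‖f j (x n)‖ * ‖y j‖ :=
        Finset.sum_le_sum fun n _ => hle _
    _ = ∑' j, ∑ n ∈ A, ‖f j (x n)‖ * ‖y j‖ :=
        (Summable.tsum_finsetSum fun n _ => hs (x n)).symm
    _ ≤ ∑' j, ‖f j‖ * ‖y j‖ * C := by
        refine Summable.tsum_le_tsum (fun j => ?_) (summable_sum fun n _ => hs (x n))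
          (hfy.mul_right C)
        rw [← Finset.sum_mul]
        have h := mul_le_mul_of_nonneg_right (hf j) (norm_nonneg (y j))
        linarith
    _ = (∑' j, ‖f j‖ * ‖y j‖) * C := tsum_mul_right

/-! ### Nuclearity forces `log n = O(α_n)` -/

namespace CoEchelon

variable {s α : ℕ → ℝ}

/-- A seminorm on `E_α` is continuous if its restrictions to the steps are bounded. -/
theorem continuous_seminorm (p : Seminorm ℂ (CoEchelon s α))
    (hp : ∀ k, ∃ C : ℝ, ∀ x, p (incl s α k x) ≤ C * ‖x‖) : Continuous p := by
  let T : CoEchelon s α →ₗ[ℂ] SeminormedBy p :=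
    { toFun := fun x => x
      map_add' := fun _ _ => rfl
      map_smul' := fun _ _ => rfl }
  have hT : Continuous T := by
    refine (continuous_iff T).2 fun k => ?_
    obtain ⟨C, hC⟩ := hp k
    exact AddMonoidHomClass.continuous_of_bound (T.comp (incl s α k)) C hC
  exact continuous_norm.comp hT

/-- The seminorm `x ↦ sup_{i, n} |c_{i, n} x_n|`. -/
noncomputable def supSeminorm (c : ℕ × ℕ → ℝ)
    (hc : ∀ x : CoEchelon s α, BddAbove (Set.range fun j => ‖(c j : ℂ) * x.1 j.2‖)) :
    Seminorm ℂ (CoEchelon s α) :=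
  Seminorm.of (fun x => ⨆ j, ‖(c j : ℂ) * x.1 j.2‖)
    (fun x y => by
      refine ciSup_le fun j => ?_
      have h : (c j : ℂ) * (x + y).1 j.2 = (c j : ℂ) * x.1 j.2 + (c j : ℂ) * y.1 j.2 :=
        mul_add _ _ _
      rw [h]
      exact (norm_add_le _ _).trans (add_le_add (le_ciSup (hc x) j) (le_ciSup (hc y) j)))
    (fun a x => by
      rw [Real.mul_iSup_of_nonneg (norm_nonneg a)]
      refine iSup_congr fun j => ?_
      have h : (c j : ℂ) * (a • x).1 j.2 = a * ((c j : ℂ) * x.1 j.2) :=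
        mul_left_comm _ _ _
      rw [h, norm_mul])

/-- For `n ≤ N i` the product is at most `(s k / s i) ^ α (N i)`. This is at most `1` when `i ≥ k`,
and only finitely many `i` remain. It makes the seminorm built from the blocks `n ≤ N i` bounded on
every step, whatever `N` is. -/
theorem exists_mul_norm_le (hs : ∀ k, 1 < s k) (hsm : StrictMono s) (hα : ∀ n, 0 < α n)
    (hαm : StrictMono α) (N : ℕ → ℕ) (k : ℕ) :
    ∃ C : ℝ, ∀ i n, n ≤ N i → s i ^ (-α (N i)) * s k ^ α n ≤ C := by
  have h0 : ∀ k, 0 < s k := fun k => zero_lt_one.trans (hs k)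
  have hb : ∀ i n, n ≤ N i → s i ^ (-α (N i)) * s k ^ α n ≤ (s k / s i) ^ α (N i) := by
    intro i n hn
    rw [Real.div_rpow (h0 k).le (h0 i).le, Real.rpow_neg (h0 i).le, div_eq_inv_mul]
    exact mul_le_mul_of_nonneg_left
      (Real.rpow_le_rpow_of_exponent_le (hs k).le (hαm.monotone hn))
      (inv_nonneg.2 (Real.rpow_nonneg (h0 i).le _))
  have hnn : ∀ i, 0 ≤ (s k / s i) ^ α (N i) := fun i =>
    Real.rpow_nonneg (div_nonneg (h0 k).le (h0 i).le) _
  refine ⟨1 + ∑ i ∈ Finset.range k, (s k / s i) ^ α (N i), fun i n hn => (hb i n hn).trans ?_⟩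
  rcases lt_or_ge i k with hik | hik
  · have h := Finset.single_le_sum (f := fun i => (s k / s i) ^ α (N i)) (fun i _ => hnn i)
      (Finset.mem_range.2 hik)
    linarith
  · have h1 : (s k / s i) ^ α (N i) ≤ 1 :=
      Real.rpow_le_one (div_nonneg (h0 k).le (h0 i).le)
        ((div_le_one (h0 i)).2 (hsm.monotone hik)) (hα _).le
    have h2 := Finset.sum_nonneg fun i (_ : i ∈ Finset.range k) => hnn i
    linarith

theorem norm_le_rpow_mul_norm (hs : ∀ k, 1 < s k) {k : ℕ} (x : C0Weighted (coWeight s α k))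
    (n : ℕ) : ‖x.1 n‖ ≤ s k ^ α n * ‖x‖ := by
  have h := x.le_norm n
  rw [norm_mul, Complex.norm_real, Real.norm_of_nonneg (coWeight_pos α hs k n).le] at h
  have h2 := (le_inv_mul_iff₀ (coWeight_pos α hs k n)).2 h
  rwa [coWeight, ← Real.rpow_neg (zero_lt_one.trans (hs k)).le, neg_neg] at h2

theorem mem_c0Submodule_of_finite {v : ℕ → ℝ} (x : ℕ → ℂ) (A : Finset ℕ)
    (hx : ∀ n ∉ A, x n = 0) : x ∈ c0Submodule v := by
  refine tendsto_const_nhds.congr' ?_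
  filter_upwards [eventually_gt_atTop (A.sup id)] with n hn
  rw [hx n fun h => (Finset.le_sup (f := id) h).not_gt hn, mul_zero]

/-- The unit vectors in the steps. -/
def unitVec (v : ℕ → ℝ) (n : ℕ) : C0Weighted v :=
  ⟨Pi.single n 1, mem_c0Submodule_of_finite _ {n} fun m hm => by
    simpa using Pi.single_eq_of_ne (M := fun _ => ℂ) (by simpa using hm) 1⟩

/-- The bound does not depend on the size of `A`; this is what contradicts absolute summability on
long blocks. -/
theorem norm_sum_unitVec_le {v : ℕ → ℝ} (hv : ∀ n, 0 < v n) (hv1 : ∀ n, v n ≤ 1) (A : Finset ℕ)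
    (ε : ℕ → ℂ) (hε : ∀ n, ‖ε n‖ ≤ 1) : ‖∑ n ∈ A, ε n • unitVec v n‖ ≤ 1 := by
  have hval : ∀ n, (∑ n ∈ A, ε n • unitVec v n).1 n = if n ∈ A then ε n else 0 := by
    intro n
    have h : (∑ n ∈ A, ε n • unitVec v n).1 = ∑ n ∈ A, ε n • (Pi.single n 1 : ℕ → ℂ) :=
      map_sum (c0Submodule v).subtype (fun n => ε n • unitVec v n) A
    rw [h, Finset.sum_apply]
    simp [Pi.single_apply]
  refine ciSup_le fun n => ?_
  rw [hval, norm_mul, Complex.norm_real, Real.norm_of_nonneg (hv n).le]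
  refine mul_le_one₀ (hv1 n) (norm_nonneg _) ?_
  split_ifs
  · exact hε n
  · simp

/-- If `E_α` is nuclear, then `log n = O(α_n)`. -/
theorem exists_le_mul_rpow_of_isNuclearLCS (hs : ∀ k, 1 < s k) (hsm : StrictMono s)
    (hα : ∀ n, 0 < α n) (hαm : StrictMono α) (hnuc : IsNuclearLCS (CoEchelon s α)) :
    ∃ i : ℕ, ∀ n : ℕ, (n : ℝ) + 1 ≤ i * s i ^ α n := by
  by_contra! hcon
  choose N hN using hcon
  have h0 : ∀ k, 0 < s k := fun k => zero_lt_one.trans (hs k)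
  -- `c` is constant on the block `n ≤ N i`, with height `s i ^ (-α (N i))`; by `hN`, its sum over
  -- that block exceeds `i`.
  let c : ℕ × ℕ → ℝ := fun j => if j.2 ≤ N j.1 then s j.1 ^ (-α (N j.1)) else 0
  have hbound : ∀ k, ∃ C : ℝ, ∀ (x : C0Weighted (coWeight s α k)) (j : ℕ × ℕ),
      ‖(c j : ℂ) * x.1 j.2‖ ≤ C * ‖x‖ := by
    intro k
    obtain ⟨C, hC⟩ := exists_mul_norm_le hs hsm hα hαm N k
    have hC0 : 0 ≤ C := (mul_nonneg (Real.rpow_nonneg (h0 0).le _)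
      (Real.rpow_nonneg (h0 k).le _)).trans (hC 0 0 (Nat.zero_le _))
    refine ⟨C, fun x j => ?_⟩
    by_cases hj : j.2 ≤ N j.1
    · have hw := Real.rpow_nonneg (h0 j.1).le (-α (N j.1))
      simp only [c, if_pos hj, norm_mul, Complex.norm_real]
      rw [Real.norm_of_nonneg hw]
      calc _ ≤ s j.1 ^ (-α (N j.1)) * (s k ^ α j.2 * ‖x‖) :=
            mul_le_mul_of_nonneg_left (norm_le_rpow_mul_norm hs x j.2) hw
        _ = (s j.1 ^ (-α (N j.1)) * s k ^ α j.2) * ‖x‖ := (mul_assoc _ _ _).symm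
        _ ≤ C * ‖x‖ := mul_le_mul_of_nonneg_right (hC _ _ hj) (norm_nonneg _)
    · simp only [c, if_neg hj, Complex.ofReal_zero, zero_mul, norm_zero]
      exact mul_nonneg hC0 (norm_nonneg _)
  have hbdd : ∀ x : CoEchelon s α, BddAbove (Set.range fun j => ‖(c j : ℂ) * x.1 j.2‖) := by
    intro x
    obtain ⟨k, hk⟩ := (mem_coechelonSubmodule hs hsm hα).1 x.2
    obtain ⟨C, hC⟩ := hbound k
    let X : C0Weighted (coWeight s α k) := ⟨x.1, hk⟩
    refine ⟨C * ‖X‖, ?_⟩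
    rintro _ ⟨j, rfl⟩
    exact hC X j
  let p := supSeminorm c hbdd
  have hp : Continuous p := continuous_seminorm p fun k => by
    obtain ⟨C, hC⟩ := hbound k
    exact ⟨C, fun x => ciSup_le fun j => hC x j⟩
  obtain ⟨q, hpq, hq, hT⟩ := hnuc p hp
  obtain ⟨K, hK⟩ := hT.exists_sum_norm_le
  obtain ⟨B, hB0, hB⟩ := Seminorm.bound_of_continuous_normedSpace (q.comp (incl s α 0))
    (hq.comp (continuous_incl 0))
  let e : ℕ → SeminormedBy q := fun n => incl s α 0 (unitVec (coWeight s α 0) n)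
  -- Absolute summability applied to the first `N i + 1` unit vectors: each has `p`-value at least
  -- `s i ^ (-α (N i))`, and `K * B` does not depend on `i`.
  have hmain : ∀ i : ℕ, ((N i : ℝ) + 1) * s i ^ (-α (N i)) ≤ K * B := by
    intro i
    have h1 := hK B (Finset.range (N i + 1)) (fun n => (e n : LocalBanach q)) fun ε hε => by
      have h2 : ∑ n ∈ Finset.range (N i + 1), ε n • (e n : LocalBanach q) =
          ((∑ n ∈ Finset.range (N i + 1), ε n • e n : SeminormedBy q) : LocalBanach q) := by
        have := map_sum (UniformSpace.Completion.toComplL (𝕜 := ℂ) (E := SeminormedBy q))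
          (fun n => ε n • e n) (Finset.range (N i + 1))
        simp only [map_smul] at this
        exact this.symm
      have h3 : (∑ n ∈ Finset.range (N i + 1), ε n • e n : SeminormedBy q) = incl s α 0
          (∑ n ∈ Finset.range (N i + 1), ε n • unitVec (coWeight s α 0) n) := by
        rw [map_sum]
        simp only [map_smul]
        rfl
      rw [h2, UniformSpace.Completion.norm_coe, h3]
      have h4 := norm_sum_unitVec_le (coWeight_pos α hs 0)
        (fun n => Real.rpow_le_one_of_one_le_of_nonpos (hs 0).le (neg_nonpos.2 (hα n).le))
        (Finset.range (N i + 1)) ε hε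
      exact (hB _).trans (mul_le_of_le_one_right hB0.le h4)
    refine le_trans ?_ h1
    have h5 : ∀ n ∈ Finset.range (N i + 1),
        s i ^ (-α (N i)) ≤ ‖linkingMap hpq (e n : LocalBanach q)‖ := by
      intro n hn
      have h6 : linkingMap hpq (e n : LocalBanach q) =
          ((seminormedMap hpq (e n) : SeminormedBy p) : LocalBanach p) :=
        UniformSpace.Completion.map_coe (seminormedMap hpq).uniformContinuous (e n)
      rw [h6, UniformSpace.Completion.norm_coe]
      have h7 : ‖(c (i, n) : ℂ) * (Pi.single n 1 : ℕ → ℂ) n‖ ≤ p (e n) :=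
        le_ciSup (hbdd (e n)) (i, n)
      have hni : n ≤ N i := Nat.lt_succ_iff.1 (Finset.mem_range.1 hn)
      rw [Pi.single_eq_same, mul_one, Complex.norm_real] at h7
      simp only [c, if_pos hni] at h7
      exact (le_abs_self _).trans h7
    have h8 := Finset.card_nsmul_le_sum _ _ _ h5
    rw [Finset.card_range, nsmul_eq_mul, Nat.cast_succ] at h8
    exact h8
  obtain ⟨i, hi⟩ := exists_nat_gt (K * B)
  have h9 := hmain i
  have h10 := hN i
  rw [Real.rpow_neg (h0 i).le, ← div_eq_mul_inv, div_le_iff₀ (Real.rpow_pos_of_pos (h0 i) _)]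
    at h9
  have h11 := mul_lt_mul_of_pos_right hi (Real.rpow_pos_of_pos (h0 i) (α (N i)))
  linarith

end CoEchelon

/-! ### Solving `x - C x = y` on the hyperplane `x_1 = 0` -/

/-- If `y_1 = 0` and `z_n = ∑_{j ≤ n, j ≥ 2} y_j / (j - 1)`, then `y + z` has the Cesàro means
`z`. -/
theorem cesaro_add_eq (y : ℕ → ℂ) (hy : y 0 = 0) :
    cesaro (fun n => y n + ∑ j ∈ Finset.range n, y (j + 1) / ((j : ℂ) + 1)) =
      fun n => ∑ j ∈ Finset.range n, y (j + 1) / ((j : ℂ) + 1) := by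
  have h : ∀ n : ℕ, ∑ i ∈ Finset.range (n + 1),
      (y i + ∑ j ∈ Finset.range i, y (j + 1) / ((j : ℂ) + 1)) =
      (∑ j ∈ Finset.range n, y (j + 1) / ((j : ℂ) + 1)) * ((n : ℂ) + 1) := by
    intro n
    induction n with
    | zero => simp [hy]
    -- With `z` the partial sums, `y_{n+1} = (n + 1) (z_{n+1} - z_n)` in 0-based indices.
    | succ n ih =>
      rw [Finset.sum_range_succ, ih, Finset.sum_range_succ]
      have hn : (n : ℂ) + 1 ≠ 0 := Nat.cast_add_one_ne_zero n
      push_cast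
      field_simp
      ring
  funext n
  exact (div_eq_iff (Nat.cast_add_one_ne_zero n)).2 (h n)

namespace CoEchelon

variable {s α : ℕ → ℝ}

/-- Under the growth condition that nuclearity yields, `E_α` contains the sequence of the partial
sums of `y_{j+1} / j` for `y ∈ E_α`. -/
theorem sum_div_mem_coechelonSubmodule (hs : ∀ k, 1 < s k) (hsm : StrictMono s)
    (hs_lim : Tendsto s atTop atTop) (hα : ∀ n, 0 < α n) (hαm : StrictMono α)
    (hα_lim : Tendsto α atTop atTop) {i : ℕ} (hi : ∀ n : ℕ, (n : ℝ) + 1 ≤ i * s i ^ α n)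
    {y : ℕ → ℂ} (hy : y ∈ coechelonSubmodule s α) :
    (fun n => ∑ j ∈ Finset.range n, y (j + 1) / ((j : ℂ) + 1)) ∈ coechelonSubmodule s α := by
  have h0 : ∀ k, 0 < s k := fun k => zero_lt_one.trans (hs k)
  obtain ⟨k, hk⟩ := (mem_coechelonSubmodule hs hsm hα).1 hy
  let Y : C0Weighted (coWeight s α k) := ⟨y, hk⟩
  -- The factor `s i` pays for the number of summands, `s k` for the growth of `y`, and `2` leaves
  -- the decay `(1 / 2) ^ α n → 0` that membership in `c₀` needs.
  obtain ⟨l, hl⟩ := (hs_lim.eventually_ge_atTop (2 * (s i * s k))).exists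
  refine (mem_coechelonSubmodule hs hsm hα).2 ⟨l, ?_⟩
  have hz : ∀ n : ℕ, ‖∑ j ∈ Finset.range n, y (j + 1) / ((j : ℂ) + 1)‖ ≤
      (i * ‖Y‖) * (s i * s k) ^ α n := by
    intro n
    have hterm : ∀ j ∈ Finset.range n, ‖y (j + 1) / ((j : ℂ) + 1)‖ ≤ s k ^ α n * ‖Y‖ := by
      intro j hj
      have hj1 : (1 : ℝ) ≤ ‖(j : ℂ) + 1‖ := by
        rw [← Nat.cast_succ, Complex.norm_natCast]
        exact_mod_cast Nat.succ_le_succ (Nat.zero_le j)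
      rw [norm_div]
      refine (div_le_self (norm_nonneg _) hj1).trans
        ((norm_le_rpow_mul_norm hs Y (j + 1)).trans ?_)
      exact mul_le_mul_of_nonneg_right (Real.rpow_le_rpow_of_exponent_le (hs k).le
        (hαm.monotone (Finset.mem_range.1 hj))) (norm_nonneg _)
    have h1 := (norm_sum_le _ _).trans (Finset.sum_le_card_nsmul _ _ _ hterm)
    rw [Finset.card_range, nsmul_eq_mul] at h1
    have hP : 0 ≤ s k ^ α n * ‖Y‖ := mul_nonneg (Real.rpow_nonneg (h0 k).le _) (norm_nonneg _)
    rw [Real.mul_rpow (h0 i).le (h0 k).le]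
    calc _ ≤ (n : ℝ) * (s k ^ α n * ‖Y‖) := h1
      _ ≤ (i * s i ^ α n) * (s k ^ α n * ‖Y‖) :=
        mul_le_mul_of_nonneg_right (by linarith [hi n]) hP
      _ = _ := by ring
  have hlim : Tendsto (fun n => (i * ‖Y‖) * (1 / 2 : ℝ) ^ α n) atTop (𝓝 0) := by
    have h := ((tendsto_rpow_atTop_of_base_lt_one (1 / 2 : ℝ) (by norm_num)
      (by norm_num)).comp hα_lim).const_mul (i * ‖Y‖)
    simpa using h
  refine squeeze_zero_norm (fun n => ?_) hlim
  rw [norm_mul, Complex.norm_real, Real.norm_of_nonneg (coWeight_pos α hs l n).le]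
  have hss : 0 < s i * s k := mul_pos (h0 i) (h0 k)
  have h2 : coWeight s α l n * (s i * s k) ^ α n ≤ (1 / 2 : ℝ) ^ α n := by
    rw [coWeight, Real.rpow_neg (h0 l).le, ← div_eq_inv_mul, ← Real.div_rpow hss.le (h0 l).le]
    refine Real.rpow_le_rpow (div_nonneg hss.le (h0 l).le) ?_ (hα n).le
    rw [div_le_iff₀ (h0 l)]
    linarith
  calc _ ≤ coWeight s α l n * ((i * ‖Y‖) * (s i * s k) ^ α n) :=
        mul_le_mul_of_nonneg_left (hz n) (coWeight_pos α hs l n).le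
    _ = (i * ‖Y‖) * (coWeight s α l n * (s i * s k) ^ α n) := by ring
    _ ≤ _ := mul_le_mul_of_nonneg_left h2 (by positivity)

theorem coord_zero_one_sub_cesaroCLM (hs : ∀ k, 1 < s k) (hαm : StrictMono α)
    (x : CoEchelon s α) : coord s α 0 ((1 - cesaroCLM hs hαm) x) = 0 := by
  have h : coord s α 0 ((1 - cesaroCLM hs hαm) x) = x.1 0 - cesaro x.1 0 := rfl
  rw [h]
  simp [cesaro]

/-- If `E_α` is nuclear, then `I - C` maps `{x | x_1 = 0}` onto itself. -/
theorem exists_one_sub_cesaroCLM_eq (hs : ∀ k, 1 < s k) (hsm : StrictMono s)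
    (hs_lim : Tendsto s atTop atTop) (hα : ∀ n, 0 < α n) (hαm : StrictMono α)
    (hα_lim : Tendsto α atTop atTop) (hnuc : IsNuclearLCS (CoEchelon s α))
    (y : CoEchelon s α) (hy : coord s α 0 y = 0) :
    ∃ x, coord s α 0 x = 0 ∧ (1 - cesaroCLM hs hαm) x = y := by
  obtain ⟨i, hi⟩ := exists_le_mul_rpow_of_isNuclearLCS hs hsm hα hαm hnuc
  have hz := sum_div_mem_coechelonSubmodule hs hsm hs_lim hα hαm hα_lim hi y.2
  have hy0 : y.1 0 = 0 := hy
  refine ⟨⟨_, (coechelonSubmodule s α).add_mem y.2 hz⟩, ?_, Subtype.ext ?_⟩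
  · change y.1 0 + ∑ j ∈ Finset.range 0, y.1 (j + 1) / ((j : ℂ) + 1) = 0
    simp [hy0]
  · change (fun n => y.1 n + ∑ j ∈ Finset.range n, y.1 (j + 1) / ((j : ℂ) + 1)) -
      cesaro (fun n => y.1 n + ∑ j ∈ Finset.range n, y.1 (j + 1) / ((j : ℂ) + 1)) = y.1
    rw [cesaro_add_eq y.1 hy0]
    funext n
    simp

/-- If `E_α` is nuclear, then `{x | x_1 = 0}` is the range of every power `(I - C)^m`, `m ≥ 1`. -/
theorem range_one_sub_cesaroCLM_pow_succ (hs : ∀ k, 1 < s k) (hsm : StrictMono s)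
    (hs_lim : Tendsto s atTop atTop) (hα : ∀ n, 0 < α n) (hαm : StrictMono α)
    (hα_lim : Tendsto α atTop atTop) (hnuc : IsNuclearLCS (CoEchelon s α)) (m : ℕ) :
    Set.range ⇑((1 - cesaroCLM hs hαm) ^ (m + 1)) = {y | coord s α 0 y = 0} := by
  refine Set.Subset.antisymm ?_ fun y hy => ?_
  · rintro _ ⟨x, rfl⟩
    rw [pow_succ']
    exact coord_zero_one_sub_cesaroCLM hs hαm _
  -- Preimages are kept in the hyperplane so that the surjectivity can be applied again.
  · have h : ∀ n : ℕ, ∃ x, coord s α 0 x = 0 ∧ ((1 - cesaroCLM hs hαm) ^ n) x = y := by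
      intro n
      induction n with
      | zero => exact ⟨y, hy, rfl⟩
      | succ n ih =>
        obtain ⟨x, hx, hxy⟩ := ih
        obtain ⟨w, hw, hwx⟩ :=
          exists_one_sub_cesaroCLM_eq hs hsm hs_lim hα hαm hα_lim hnuc x hx
        refine ⟨w, hw, ?_⟩
        rw [pow_succ, mul_apply_eq_comp, hwx, hxy]
    obtain ⟨x, -, hx⟩ := h (m + 1)
    exact ⟨x, hx⟩

end CoEchelon

theorem proposition4p3 (α : ℕ → ℝ) (hα_pos : ∀ n, 0 < α n) (hα_mono : StrictMono α)
    (hα_lim : Tendsto α atTop atTop)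
    (s : ℕ → ℝ) (hs_one : ∀ k, 1 < s k) (hs_mono : StrictMono s) (hs_lim : Tendsto s atTop atTop)
    (hnuc : IsNuclearLCS (CoEchelon s α)) (m : ℕ) :
    IsClosed (Set.range ⇑((1 - CoEchelon.cesaroCLM hs_one hα_mono) ^ m)) := by
  cases m with
  | zero =>
    have h : Set.range ⇑((1 - CoEchelon.cesaroCLM hs_one hα_mono) ^ (0 : ℕ)) = Set.univ :=
      Set.range_eq_univ.2 fun x => ⟨x, rfl⟩
    rw [h]
    exact isClosed_univ
  | succ m =>
    rw [CoEchelon.range_one_sub_cesaroCLM_pow_succ hs_one hs_mono hs_lim hα_pos hα_mono hα_lim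
      hnuc m]
    exact isClosed_singleton.preimage (CoEchelon.continuous_coord hs_one 0)
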